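/- Fix an integer $k\ge 2$. All series are formal series in $q$ over a field $K$ (for instance $K=\mathbb{C}$), and infinite sums and products converge formally, i.e. coefficientwise. Put $$F(q)=\prod_{\substack{m\ge 1\\ m\not\equiv 2\ (\mathrm{mod}\ 4)}}(1-q^m).$$ Define a sequence $G_l(q)$, $l\ge 1$, as follows. For $1\le i\le k$ let $$G_i(q)=\prod_{\substack{m\ge 1,\ m\not\equiv 2\ (\mathrm{mod}\ 4)\\ m\not\equiv 0,\,2k\pm(2i-1)\ (\mathrm{mod}\ 4k)}}(1-q^m)^{-1},$$ and for $j\ge 1$ and $2\le i\le k$ let, recursively (a priori as formal Laurent series), $$G_{(k-1)j+i}(q)=\frac{G_{(k-1)(j-1)+k-i+1}(q)-G_{(k-1)(j-1)+k-i+2}(q)}{q^{2j(i-1)}}-q^{-1}G_{(k-1)j+i-1}(q).$$ (Every $l>k$ is $(k-1)j+i$ for exactly one such pair $(j,i)$, so this defines all $G_l(q)$, $l\ge 1$.) **Theorem.** For all $j\ge 0$ and $1\le i\le k$, the sum below converges formally and $$G_{(k-1)j+i}(q)=\frac{1}{F(q)}\sum_{n\ge 0}\frac{(-1)^n q^{4k\binom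 n2+(2k(j+1)+2i-1)n}\,\prod_{r=1}^{j}(1-q^{2(n+r)})}{\prod_{r=0}^{j}(1+q^{2(n+r)+1})}\Bigl(1-q^{2(k-i+1)(2n+j+1)}+q^{2(n+j)+1}\bigl(1-q^{2(k-i)(2n+j+1)}\bigr)\Bigr).$$ In particular, every $G_l(q)$ is a formal power series. -/

import Mathlib

open PowerSeries
open scoped PowerSeries LaurentSeries PowerSeries.WithPiTopology

namespace GGA

noncomputable section

/- Formal power series `K⟦X⟧` carry the product (coefficientwise) topology; with the discrete topology
on `K`, a sum or product converges exactly when every coefficient is eventually constant,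
which is convergence of formal power series. -/

/-- A factor-by-factor criterion for formal convergence of an infinite product. -/
theorem multipliable_of_X_pow_dvd {K : Type*} [Field K] [TopologicalSpace K] (f : ℕ → K⟦X⟧)
    (h : ∀ m, (X : K⟦X⟧) ^ m ∣ f m - 1) : Multipliable f := by
  have h1 : Multipliable (fun m ↦ 1 + (f m - 1)) := by
    apply WithPiTopology.multipliable_one_add_of_tendsto_order_atTop_nhds_top
    refine ENat.tendsto_nhds_top_iff_natCast_lt.mpr
      (fun n ↦ Filter.eventually_atTop.mpr ⟨n + 1, fun m hm ↦ ?_⟩)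
    refine lt_of_lt_of_le ?_ (nat_le_order _ m fun d hd ↦ X_pow_dvd_iff.mp (h m) d hd)
    exact_mod_cast hm
  simpa using h1

/-- The `m`-th factor of `F(q) = ∏_{m ≥ 1, m ≢ 2 (mod 4)} (1 - q^m)`. -/
def FFactor (K : Type*) [Field K] (m : ℕ) : K⟦X⟧ :=
  if 1 ≤ m ∧ ¬ m ≡ 2 [MOD 4] then 1 - X ^ m else 1

/-- `F(q) = ∏_{m ≥ 1, m ≢ 2 (mod 4)} (1 - q^m)`. -/
def F (K : Type*) [Field K] [TopologicalSpace K] : K⟦X⟧ :=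
  ∏' m : ℕ, FFactor K m

/-- The `m`-th factor of the product side: `(1 - q^m)⁻¹` if `m ≥ 1`, `m ≢ 2 (mod 4)` and
`m ≢ 0, 2k ± (2i-1) (mod 4k)`, and `1` otherwise. -/
def productFactor (K : Type*) [Field K] (k i m : ℕ) : K⟦X⟧ :=
  if 1 ≤ m ∧ ¬ m ≡ 2 [MOD 4] ∧ ¬ (m : ℤ) ≡ 0 [ZMOD 4 * k] ∧
      ¬ (m : ℤ) ≡ 2 * k + (2 * i - 1) [ZMOD 4 * k] ∧
      ¬ (m : ℤ) ≡ 2 * k - (2 * i - 1) [ZMOD 4 * k]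
  then (1 - X ^ m)⁻¹ else 1

/-- The product side of the `i`-th Göllnitz-Gordon-Andrews identity. -/
def productSide (K : Type*) [Field K] [TopologicalSpace K] (k i : ℕ) : K⟦X⟧ :=
  ∏' m : ℕ, productFactor K k i m

/-- The product defining `F` converges. -/
theorem multipliable_FFactor (K : Type*) [Field K] [TopologicalSpace K] :
    Multipliable (FFactor K) := by
  apply multipliable_of_X_pow_dvd
  intro m
  unfold FFactor
  split_ifs <;> simp

/-- `F` has constant term `1`, so it is invertible in `K⟦X⟧`. -/
theorem constantCoeff_F (K : Type*) [Field K] [TopologicalSpace K] [T2Space K] :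
    constantCoeff (F K) = 1 := by
  have h : ∀ m, constantCoeff (FFactor K m) = 1 := by
    intro m
    unfold FFactor
    split_ifs with h
    · have hm : m ≠ 0 := by omega
      simp [hm]
    · simp
  rw [F, (multipliable_FFactor K).map_tprod _ (WithPiTopology.continuous_constantCoeff K)]
  simp [h]

/-- The products defining the product sides converge. -/
theorem multipliable_productFactor (K : Type*) [Field K] [TopologicalSpace K] (k i : ℕ) :
    Multipliable (productFactor K k i) := by
  apply multipliable_of_X_pow_dvd
  intro m
  unfold productFactor
  split_ifs with h
  · have hm : m ≠ 0 := by omega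
    have hc : constantCoeff (1 - X ^ m : K⟦X⟧) ≠ 0 := by simp [hm]
    refine ⟨(1 - X ^ m)⁻¹, ?_⟩
    have := PowerSeries.mul_inv_cancel _ hc
    linear_combination this
  · simp

/-- The formal variable `q` as a Laurent series. -/
def q (K : Type*) [Field K] : K⸨X⸩ := ((X : K⟦X⟧) : K⸨X⸩)

theorem index_aux {k l : ℕ} (hk : 2 ≤ k) (hl : k < l) :
    1 ≤ (l - 2) / (k - 1) ∧ 2 ≤ (l - 2) % (k - 1) + 2 ∧ (l - 2) % (k - 1) + 2 ≤ k ∧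
      (k - 1) * ((l - 2) / (k - 1) - 1) + (k - 1) + ((l - 2) % (k - 1) + 2) = l := by
  have h1 : 1 ≤ (l - 2) / (k - 1) := (Nat.le_div_iff_mul_le (by omega)).2 (by omega)
  have h2 := Nat.mod_lt (l - 2) (show 0 < k - 1 by omega)
  have h3 := Nat.div_add_mod (l - 2) (k - 1)
  obtain ⟨d, hd⟩ := Nat.exists_eq_add_of_le h1
  rw [hd] at h3 ⊢
  rw [Nat.mul_add, Nat.mul_one] at h3
  simp only [Nat.add_sub_cancel_left]
  omega

/-- The series `G_l(q)`, `l ≥ 1`, for fixed `k ≥ 2`. For `l ≤ k` it is the product side; for `l > k`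
write `l = (k-1)j + i` with `j ≥ 1` and `2 ≤ i ≤ k` (in exactly one way) and put
`G_l = (G_{(k-1)(j-1)+k-i+1} - G_{(k-1)(j-1)+k-i+2}) / q^{2j(i-1)} - q⁻¹ G_{(k-1)j+i-1}`.
Since this divides by powers of `q`, the series are defined as Laurent series. The values for
`l = 0` or `k < 2` carry no meaning. -/
def G (K : Type*) [Field K] [TopologicalSpace K] (k l : ℕ) : K⸨X⸩ :=
  if _h : 2 ≤ k ∧ k < l then
    let j := (l - 2) / (k - 1)
    let i := (l - 2) % (k - 1) + 2
    (G K k ((k - 1) * (j - 1) + k - i + 1) - G K k ((k - 1) * (j - 1) + k - i + 2)) /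
        q K ^ (2 * j * (i - 1)) - (q K)⁻¹ * G K k (l - 1)
  else (productSide K k l : K⸨X⸩)
termination_by l
decreasing_by
  all_goals
    have := index_aux _h.1 _h.2
    omega

/-- The `0`-th shelf consists of the product sides. -/
theorem G_zeroth_shelf (K : Type*) [Field K] [TopologicalSpace K] (k i : ℕ) (hi : i ≤ k) :
    G K k i = (productSide K k i : K⸨X⸩) := by
  rw [G, dif_neg (by omega)]

/-- The recursion for the higher shelves. -/
theorem G_recursion (K : Type*) [Field K] [TopologicalSpace K] (k j i : ℕ) (hk : 2 ≤ k)
    (hj : 1 ≤ j) (hi : 2 ≤ i) (hik : i ≤ k) :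
    G K k ((k - 1) * j + i) =
      (G K k ((k - 1) * (j - 1) + k - i + 1) - G K k ((k - 1) * (j - 1) + k - i + 2)) /
          q K ^ (2 * j * (i - 1)) - (q K)⁻¹ * G K k ((k - 1) * j + i - 1) := by
  have hjm : k - 1 ≤ (k - 1) * j := Nat.le_mul_of_pos_right _ hj
  have e : (k - 1) * j + i - 2 = (i - 2) + (k - 1) * j := by omega
  have hd : ((k - 1) * j + i - 2) / (k - 1) = j := by
    rw [e, Nat.add_mul_div_left _ _ (by omega), Nat.div_eq_of_lt (by omega), zero_add]
  have hm : ((k - 1) * j + i - 2) % (k - 1) = i - 2 := by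
    rw [e, Nat.add_mul_mod_self_left, Nat.mod_eq_of_lt (by omega)]
  rw [G, dif_pos ⟨hk, by omega⟩]
  simp only [hd, hm, Nat.sub_add_cancel hi]

/-- The `n`-th term of the alternating sum for `G_{(k-1)j+i}(q)`, for `1 ≤ i ≤ k`. The denominator
has constant term `1`, so it is invertible in `K⟦X⟧`. -/
def term (K : Type*) [Field K] (k j i n : ℕ) : K⟦X⟧ :=
  (-1) ^ n * X ^ (4 * k * n.choose 2 + (2 * k * (j + 1) + 2 * i - 1) * n) *
    (∏ r ∈ Finset.Icc 1 j, (1 - X ^ (2 * (n + r)))) *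
    (∏ r ∈ Finset.Icc 0 j, (1 + X ^ (2 * (n + r) + 1)))⁻¹ *
    (1 - X ^ (2 * (k - i + 1) * (2 * n + j + 1)) +
      X ^ (2 * (n + j) + 1) * (1 - X ^ (2 * (k - i) * (2 * n + j + 1))))

end

end GGA

/-! Write S(j,i) for the alternating sum. The claim F·G = S is proved by showing that S has the
initial values and the recursion that determine G. On shelf 0, multiplying the product side by F
leaves exactly the factors 1 - q^m with m ≡ 0, 2k ± (2i-1) mod 4k, since none of these m is 2 mod 4.
The Jacobi triple product (`tsum_thetaTerm`) turns this product into a bilateral theta series.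
Pairing the indices n and -(n+1) gives S(0,i), because for j = 0 the last bracket is divisible by
the denominator 1 + q^(2n+1). For higher shelves two facts are needed: the edge matching S(j+1,1) =
S(j,k), as both describe the same G_l, and the recursion for i ≥ 2. Each summand on shelf j splits
as U n + V n with U 0 = 0. Regrouping as V n + U (n+1) gives the summands on shelf j+1
(`tsum_term_first`, `tsum_term_recursion`). Termwise this uses only the two relations between the
quotients `ratio` on adjacent shelves. -/

namespace GGA

/-! ### Gaussian binomials and the finite q-binomial theorem. -/

/-- Gaussian binomial coefficients, defined by the `q`-Pascal rule. -/
def gaussBinom {R : Type*} [CommRing R] (Q : R) : ℕ → ℕ → R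
  | _, 0 => 1
  | 0, _ + 1 => 0
  | L + 1, l + 1 => Q ^ (l + 1) * gaussBinom Q L (l + 1) + gaussBinom Q L l

section GaussBinom

variable {R : Type*} [CommRing R] (Q : R)

theorem gaussBinom_zero_right (L : ℕ) : gaussBinom Q L 0 = 1 := by
  cases L <;> rfl

theorem gaussBinom_succ_succ (L l : ℕ) :
    gaussBinom Q (L + 1) (l + 1) = Q ^ (l + 1) * gaussBinom Q L (l + 1) + gaussBinom Q L l := rfl

theorem gaussBinom_eq_zero_of_lt {L l : ℕ} (h : L < l) : gaussBinom Q L l = 0 := by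
  induction L generalizing l with
  | zero =>
    obtain ⟨l, rfl⟩ := Nat.exists_eq_add_of_lt h
    rfl
  | succ L ih =>
    obtain ⟨l, rfl⟩ : ∃ m, l = m + 1 := ⟨l - 1, by omega⟩
    rw [gaussBinom_succ_succ, ih (by omega), ih (by omega)]
    simp

theorem gaussBinom_self (L : ℕ) : gaussBinom Q L L = 1 := by
  induction L with
  | zero => rfl
  | succ L ih => rw [gaussBinom_succ_succ, ih, gaussBinom_eq_zero_of_lt Q (by omega)]; simp

/-- `(Q;Q)_n`. -/
def qPoch (n : ℕ) : R := ∏ m ∈ Finset.range n, (1 - Q ^ (m + 1))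

/-- The factorial formula for Gaussian binomials with denominators cleared, so that it holds for
every Q. The two terms of the Pascal rule are handled by the inner and outer induction hypotheses.
-/
theorem gaussBinom_mul_qPoch (l d : ℕ) :
    gaussBinom Q (l + d) l * qPoch Q l * qPoch Q d = qPoch Q (l + d) := by
  induction l generalizing d with
  | zero => simp [gaussBinom_zero_right, qPoch]
  | succ l ihl =>
    induction d with
    | zero => simp [gaussBinom_self, qPoch]
    | succ d ihd =>
      have h1 := ihl (d + 1)
      have e : l + 1 + (d + 1) = (l + 1 + d) + 1 := by ring
      have e' : l + (d + 1) = l + 1 + d := by ring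
      rw [e'] at h1
      rw [e, gaussBinom_succ_succ]
      have hs : ∀ n, qPoch Q (n + 1) = qPoch Q n * (1 - Q ^ (n + 1)) := fun n ↦ by
        simp [qPoch, Finset.prod_range_succ]
      rw [hs (l + 1 + d), hs l, hs d]
      rw [hs d] at h1
      rw [hs l] at ihd
      linear_combination Q ^ (l + 1) * (1 - Q ^ (d + 1)) * ihd + (1 - Q ^ (l + 1)) * h1

theorem qPoch_add (B d : ℕ) :
    qPoch Q (B + d) = qPoch Q B * ∏ m ∈ Finset.range d, (1 - Q ^ (B + m + 1)) := by
  simp [qPoch, Finset.prod_range_add]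

/-- Rothe's identity (the finite `q`-binomial theorem) in homogeneous form. -/
theorem prod_add_mul_pow (x y : R) (L : ℕ) :
    ∏ m ∈ Finset.range L, (y + x * Q ^ m) =
      ∑ l ∈ Finset.range (L + 1), gaussBinom Q L l * Q ^ l.choose 2 * x ^ l * y ^ (L - l) := by
  induction L generalizing x with
  | zero => simp [gaussBinom_zero_right]
  | succ L ih =>
    -- Splitting off the factor m = 0 leaves the same product with x replaced by x * Q, hence the
    -- induction over all x.
    have h : ∏ m ∈ Finset.range L, (y + x * Q ^ (m + 1)) =
        ∏ m ∈ Finset.range L, (y + (x * Q) * Q ^ m) :=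
      Finset.prod_congr rfl fun m _ ↦ by ring
    rw [Finset.prod_range_succ', h, ih, Finset.sum_range_succ' _ (L + 1)]
    have h2 : ∀ l ∈ Finset.range (L + 1),
        gaussBinom Q (L + 1) (l + 1) * Q ^ (l + 1).choose 2 * x ^ (l + 1) * y ^ (L + 1 - (l + 1)) =
        (gaussBinom Q L l * Q ^ l.choose 2 * (x * Q) ^ l * y ^ (L - l)) * x +
        gaussBinom Q L (l + 1) * Q ^ (l + 1).choose 2 * (x * Q) ^ (l + 1) * y ^ (L - l) := by
      intro l _
      have e : (l + 1).choose 2 = l + l.choose 2 := by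
        rw [Nat.choose_succ_succ' l 1, Nat.choose_one_right]
      rw [gaussBinom_succ_succ, e, Nat.add_sub_add_right]
      ring
    rw [Finset.sum_congr rfl h2, Finset.sum_add_distrib, ← Finset.sum_mul]
    have h3 : (∑ l ∈ Finset.range (L + 1), gaussBinom Q L l * Q ^ l.choose 2 * (x * Q) ^ l *
        y ^ (L - l)) * y = ∑ l ∈ Finset.range (L + 1),
          gaussBinom Q L (l + 1) * Q ^ (l + 1).choose 2 * (x * Q) ^ (l + 1) * y ^ (L - l) +
          y ^ (L + 1) := by
      rw [Finset.sum_range_succ', Finset.sum_range_succ _ L, gaussBinom_eq_zero_of_lt Q (l := L + 1)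
        (by omega), add_mul, Finset.sum_mul]
      simp only [gaussBinom_zero_right, zero_mul, add_zero, Nat.choose_zero_succ, pow_zero, mul_one,
        one_mul, Nat.sub_zero, pow_succ y L]
      congr 1
      refine Finset.sum_congr rfl fun l hl ↦ ?_
      have : L - l = L - (l + 1) + 1 := by have := Finset.mem_range.mp hl; omega
      rw [this, pow_succ]
      ring
    simp only [gaussBinom_zero_right, Nat.choose_zero_succ, pow_zero, mul_one, one_mul, Nat.sub_zero]
    linear_combination h3

end GaussBinom

end GGA
namespace GGA

/-! ### The Jacobi triple product, as a limit of its finite form. -/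

section TripleProduct

variable {K : Type*} [Field K]

theorem dvd_prod_one_sub_sub_one {R ι : Type*} [CommRing R] (y : R) (s : Finset ι) (f : ι → R)
    (h : ∀ m ∈ s, y ∣ f m) : y ∣ ∏ m ∈ s, (1 - f m) - 1 := by
  induction s using Finset.cons_induction with
  | empty => simp
  | cons a s ha ih =>
    rw [Finset.prod_cons]
    obtain ⟨u, hu⟩ := ih fun m hm ↦ h m (Finset.mem_cons_of_mem hm)
    obtain ⟨v, hv⟩ := h a (Finset.mem_cons_self a s)
    exact ⟨u - v * ∏ m ∈ s, (1 - f m), by linear_combination hu - (∏ m ∈ s, (1 - f m)) * hv⟩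

theorem qPoch_X_pow_ne_zero {c : ℕ} (hc : 1 ≤ c) (n : ℕ) : qPoch ((X : K⟦X⟧) ^ c) n ≠ 0 := by
  intro h
  have h' := congrArg constantCoeff h
  have : c ≠ 0 := by omega
  simp [qPoch, this] at h'

/-- With N = n + d this is [2N, N+n] · (Q;Q)_N. Cancelling (Q;Q)_(2n+d) leaves only factors 1 - Q^e
with e > d, which makes the product 1 modulo X^(d+1). -/
theorem gaussBinom_mul_qPoch_eq {c : ℕ} (hc : 1 ≤ c) (n d : ℕ) :
    gaussBinom ((X : K⟦X⟧) ^ c) (2 * n + d + d) (2 * n + d) * qPoch (X ^ c) (n + d) =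
      (∏ m ∈ Finset.range d, (1 - (X ^ c) ^ (2 * n + d + m + 1))) *
      ∏ m ∈ Finset.range n, (1 - (X ^ c) ^ (d + m + 1)) := by
  have h := gaussBinom_mul_qPoch ((X : K⟦X⟧) ^ c) (2 * n + d) d
  rw [qPoch_add _ (2 * n + d) d] at h
  apply mul_left_cancel₀ (qPoch_X_pow_ne_zero (K := K) hc (2 * n + d))
  rw [add_comm n d, qPoch_add _ d n]
  linear_combination (∏ m ∈ Finset.range n, (1 - ((X : K⟦X⟧) ^ c) ^ (d + m + 1))) * h

theorem gaussBinom_symm {c : ℕ} (hc : 1 ≤ c) (l d : ℕ) :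
    gaussBinom ((X : K⟦X⟧) ^ c) (l + d) l = gaussBinom (X ^ c) (l + d) d := by
  have h := gaussBinom_mul_qPoch ((X : K⟦X⟧) ^ c) l d
  have h' := gaussBinom_mul_qPoch ((X : K⟦X⟧) ^ c) d l
  rw [add_comm d l] at h'
  apply mul_right_cancel₀ (mul_ne_zero (qPoch_X_pow_ne_zero (K := K) hc l)
    (qPoch_X_pow_ne_zero (K := K) hc d))
  linear_combination h - h'

theorem X_pow_dvd_gaussBinom_mul_qPoch_sub_one {c : ℕ} (hc : 1 ≤ c) (n d : ℕ) :
    (X : K⟦X⟧) ^ (d + 1) ∣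
      gaussBinom (X ^ c) (2 * n + d + d) (2 * n + d) * qPoch (X ^ c) (n + d) - 1 := by
  have h : ∀ N, d + 1 ≤ N → (X : K⟦X⟧) ^ (d + 1) ∣ (X ^ c) ^ N := fun N hN ↦ by
    rw [← pow_mul]
    exact pow_dvd_pow _ (hN.trans (Nat.le_mul_of_pos_left _ hc))
  rw [gaussBinom_mul_qPoch_eq hc]
  obtain ⟨u, hu⟩ := dvd_prod_one_sub_sub_one ((X : K⟦X⟧) ^ (d + 1)) (Finset.range d)
    (fun m ↦ (X ^ c) ^ (2 * n + d + m + 1)) fun m _ ↦ h _ (by omega)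
  obtain ⟨v, hv⟩ := dvd_prod_one_sub_sub_one ((X : K⟦X⟧) ^ (d + 1)) (Finset.range n)
    (fun m ↦ (X ^ c) ^ (d + m + 1)) fun m _ ↦ h _ (by omega)
  refine ⟨u * ∏ m ∈ Finset.range n, (1 - (X ^ c) ^ (d + m + 1)) + v, ?_⟩
  linear_combination (∏ m ∈ Finset.range n, (1 - ((X : K⟦X⟧) ^ c) ^ (d + m + 1))) * hu + hv

theorem choose_two_add (m n : ℕ) : (m + n).choose 2 = m.choose 2 + n.choose 2 + m * n := by
  have h := Nat.add_choose_eq m n 2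
  simp [Finset.Nat.antidiagonal_succ] at h
  omega

/-- The finite form of the Jacobi triple product. -/
theorem finite_triple_product (a b N : ℕ) :
    ∏ m ∈ Finset.range N, ((1 - (X : K⟦X⟧) ^ ((a + b) * m + a)) * (1 - X ^ ((a + b) * m + b))) =
      ∑ n ∈ Finset.range (N + 1), (-1) ^ n * X ^ ((a + b) * n.choose 2 + b * n) *
        gaussBinom (X ^ (a + b)) (2 * N) (N + n) +
      ∑ n ∈ Finset.range N, (-1) ^ (n + 1) * X ^ ((a + b) * (n + 1).choose 2 + a * (n + 1)) *
        gaussBinom (X ^ (a + b)) (2 * N) (N - 1 - n) := by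
  set c := a + b with hc
  -- Taking y = X^(cN) in the homogeneous form avoids negative exponents. The monomial W below is
  -- that of the central summand l = N; it is cancelled from both sides.
  have h := prod_add_mul_pow ((X : K⟦X⟧) ^ c) (-X ^ b) (X ^ (c * N)) (N + N)
  set W : K⟦X⟧ := (-1) ^ N * X ^ (b * N + c * N.choose 2 + c * N * N) with hW
  have hW0 : W ≠ 0 := by simp [hW, X_ne_zero]
  have hL : ∏ m ∈ Finset.range (N + N), ((X : K⟦X⟧) ^ (c * N) + -X ^ b * (X ^ c) ^ m) = W *
      ∏ m ∈ Finset.range N, ((1 - (X : K⟦X⟧) ^ (c * m + a)) * (1 - X ^ (c * m + b))) := by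
    rw [Finset.prod_range_add, ← Finset.prod_range_reflect, Finset.prod_mul_distrib]
    have h1 : ∀ m ∈ Finset.range N, (X : K⟦X⟧) ^ (c * N) + -X ^ b * (X ^ c) ^ (N - 1 - m) =
        (-1 * (X ^ b * X ^ (c * (N - 1 - m)))) * (1 - (X : K⟦X⟧) ^ (c * m + a)) := fun m hm ↦ by
      obtain ⟨d, rfl⟩ := Nat.exists_eq_add_of_lt (Finset.mem_range.mp hm)
      have : m + d + 1 - 1 - m = d := by omega
      rw [this, hc]
      ring
    have h2 : ∀ m ∈ Finset.range N, (X : K⟦X⟧) ^ (c * N) + -X ^ b * (X ^ c) ^ (N + m) =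
        X ^ (c * N) * (1 - (X : K⟦X⟧) ^ (c * m + b)) := fun m _ ↦ by ring
    have h3 : ∏ m ∈ Finset.range N, (X : K⟦X⟧) ^ (c * m) = X ^ (c * N.choose 2) := by
      rw [Finset.prod_pow_eq_pow_sum, ← Finset.mul_sum, Finset.sum_range_id, ← Nat.choose_two_right]
    rw [Finset.prod_congr rfl h1, Finset.prod_congr rfl h2, Finset.prod_mul_distrib,
      Finset.prod_mul_distrib, Finset.prod_mul_distrib, Finset.prod_mul_distrib,
      Finset.prod_range_reflect (fun m ↦ (X : K⟦X⟧) ^ (c * m)), h3]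
    simp only [Finset.prod_const, Finset.card_range, hW]
    ring
  apply mul_left_cancel₀ hW0
  rw [← hL, h, add_assoc N N 1, Finset.sum_range_add, add_comm, mul_add, Finset.mul_sum,
    Finset.mul_sum, ← two_mul]
  congr 1
  -- Summands l = N + n.
  · refine Finset.sum_congr rfl fun n hn ↦ ?_
    obtain ⟨d, rfl⟩ := Nat.exists_eq_add_of_le (Nat.lt_succ_iff.mp (Finset.mem_range.mp hn))
    have : 2 * (n + d) - (n + d + n) = d := by omega
    rw [this, choose_two_add (n + d) n, hW, neg_pow]
    ring
  -- Summands l = N - 1 - n, which carry the bilateral index -(n+1).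
  · rw [← Finset.sum_range_reflect]
    refine Finset.sum_congr rfl fun n hn ↦ ?_
    obtain ⟨d, rfl⟩ := Nat.exists_eq_add_of_lt (Finset.mem_range.mp hn)
    have e1 : n + d + 1 - 1 - n = d := by omega
    have e2 : 2 * (n + d + 1) - d = 2 * n + d + 2 := by omega
    have e3 : (n + d + 1).choose 2 = d.choose 2 + (n + 1).choose 2 + d * (n + 1) := by
      rw [← choose_two_add]; congr 1; ring
    have e4 : (-1 : K⟦X⟧) ^ (n + d + 1) * (-1) ^ (n + 1) = (-1) ^ d := by
      rw [← pow_add, show n + d + 1 + (n + 1) = 2 * (n + 1) + d by ring, pow_add, pow_mul]; simp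
    have e5 : 2 * (n + 1).choose 2 = (n + 1) * n := by
      rw [Nat.choose_two_right, Nat.mul_div_cancel' (Nat.even_mul_pred_self (n + 1)).two_dvd]
      simp
    have e6 : c * d.choose 2 + b * d + c * (n + d + 1) * (2 * n + d + 2) =
        b * (n + d + 1) + c * (n + d + 1).choose 2 + c * (n + d + 1) * (n + d + 1) +
        (c * (n + 1).choose 2 + a * (n + 1)) := by
      rw [e3, hc]
      zify at e5 ⊢
      linear_combination (-(a + b : ℤ)) * e5
    rw [e1, e2, hW, neg_pow, ← e4]
    have e7 := congrArg (fun e ↦ (X : K⟦X⟧) ^ e) e6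
    simp only [pow_add _ (c * d.choose 2 + b * d), pow_add _ (c * d.choose 2),
      pow_add _ (b * (n + d + 1) + c * (n + d + 1).choose 2 + c * (n + d + 1) * (n + d + 1))] at e7
    rw [← pow_mul, ← pow_mul, ← pow_mul]
    linear_combination (-1 : K⟦X⟧) ^ (n + d + 1) * (-1) ^ (n + 1) *
      gaussBinom (X ^ c) (2 * (n + d + 1)) d * e7

/-- The summand of the bilateral theta series, with the indices `n` and `-(n+1)` paired. -/
noncomputable def thetaTerm (K : Type*) [Field K] (a b n : ℕ) : K⟦X⟧ :=
  (-1) ^ n * (X ^ ((a + b) * n.choose 2 + b * n) - X ^ ((a + b) * (n + 1).choose 2 + a * (n + 1)))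

/-- After multiplication by (q^c;q^c)_N, where c = a + b, each Gaussian binomial is 1 up to an error
of order at least N - n, while its monomial has order at least n, so every error has order at least
N. -/
theorem X_pow_dvd_finite_triple_product_sub {a b : ℕ} (ha : 1 ≤ a) (hb : 1 ≤ b) (N : ℕ) :
    (X : K⟦X⟧) ^ N ∣ ∏ m ∈ Finset.range N, ((1 - X ^ ((a + b) * (m + 1))) *
        ((1 - (X : K⟦X⟧) ^ ((a + b) * m + a)) * (1 - X ^ ((a + b) * m + b)))) -
      ∑ n ∈ Finset.range N, thetaTerm K a b n := by
  have hc : 1 ≤ a + b := by omega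
  have hp : ∏ m ∈ Finset.range N, (1 - (X : K⟦X⟧) ^ ((a + b) * (m + 1))) =
      qPoch (X ^ (a + b)) N := by
    simp only [qPoch, pow_mul]
  rw [Finset.prod_mul_distrib, hp, finite_triple_product, Finset.sum_range_succ, mul_add, mul_add,
    Finset.mul_sum, Finset.mul_sum]
  have e : ∀ s s' t t' z : K⟦X⟧, s + z + s' - (t + t') = (s - t) + (s' - t') + z := by
    intros; ring
  have hT : ∑ n ∈ Finset.range N, thetaTerm K a b n =
      ∑ n ∈ Finset.range N, (-1) ^ n * X ^ ((a + b) * n.choose 2 + b * n) +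
      ∑ n ∈ Finset.range N, (-1) ^ (n + 1) * X ^ ((a + b) * (n + 1).choose 2 + a * (n + 1)) := by
    rw [← Finset.sum_add_distrib]
    exact Finset.sum_congr rfl fun n _ ↦ by rw [thetaTerm]; ring
  rw [hT, e, ← Finset.sum_sub_distrib, ← Finset.sum_sub_distrib]
  refine dvd_add (dvd_add (Finset.dvd_sum fun n hn ↦ ?_) (Finset.dvd_sum fun n hn ↦ ?_)) ?_
  · obtain ⟨d, rfl⟩ := Nat.exists_eq_add_of_lt (Finset.mem_range.mp hn)
    obtain ⟨u, hu⟩ := X_pow_dvd_gaussBinom_mul_qPoch_sub_one (K := K) hc n (d + 1)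
    have e1 : 2 * (n + d + 1) = 2 * n + (d + 1) + (d + 1) := by ring
    have e2 : n + d + 1 + n = 2 * n + (d + 1) := by ring
    rw [e1, e2, add_assoc n d 1]
    have h1 : (X : K⟦X⟧) ^ (n + (d + 1)) ∣ X ^ ((a + b) * n.choose 2 + b * n) * X ^ (d + 1 + 1) := by
      rw [← pow_add]
      apply pow_dvd_pow
      nlinarith [Nat.le_mul_of_pos_left n hb]
    obtain ⟨v, hv⟩ := h1
    refine ⟨(-1) ^ n * u * v, ?_⟩
    linear_combination
      (-1) ^ n * X ^ ((a + b) * n.choose 2 + b * n) * hu + (-1) ^ n * u * hv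
  · obtain ⟨d, rfl⟩ := Nat.exists_eq_add_of_lt (Finset.mem_range.mp hn)
    obtain ⟨u, hu⟩ := X_pow_dvd_gaussBinom_mul_qPoch_sub_one (K := K) hc (n + 1) d
    have e1 : 2 * (n + d + 1) = 2 * (n + 1) + d + d := by ring
    have e2 : n + d + 1 - 1 - n = d := by omega
    have e3 : n + d + 1 = n + 1 + d := by ring
    rw [gaussBinom_symm hc, ← e1, e3] at hu
    rw [e2, e3]
    have h1 : (X : K⟦X⟧) ^ (n + 1 + d) ∣
        X ^ ((a + b) * (n + 1).choose 2 + a * (n + 1)) * X ^ (d + 1) := by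
      rw [← pow_add]
      apply pow_dvd_pow
      nlinarith [Nat.le_mul_of_pos_left (n + 1) ha]
    obtain ⟨v, hv⟩ := h1
    refine ⟨(-1) ^ (n + 1) * u * v, ?_⟩
    linear_combination
      (-1) ^ (n + 1) * X ^ ((a + b) * (n + 1).choose 2 + a * (n + 1)) * hu +
      (-1) ^ (n + 1) * u * hv
  -- The unpaired summand n = N is itself divisible by X^N.
  · refine Dvd.dvd.mul_left (Dvd.dvd.mul_right (Dvd.dvd.mul_left (pow_dvd_pow _ ?_) _) _) _
    nlinarith [Nat.le_mul_of_pos_left N hb]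

theorem X_pow_dvd_thetaTerm {a b : ℕ} (ha : 1 ≤ a) (hb : 1 ≤ b) (n : ℕ) :
    (X : K⟦X⟧) ^ n ∣ thetaTerm K a b n := by
  refine Dvd.dvd.mul_left (dvd_sub (pow_dvd_pow _ ?_) (pow_dvd_pow _ ?_)) _
  · nlinarith [Nat.le_mul_of_pos_left n hb]
  · nlinarith [Nat.le_mul_of_pos_left (n + 1) ha]

variable [TopologicalSpace K]

theorem summable_of_X_pow_dvd (f : ℕ → K⟦X⟧) (h : ∀ m, (X : K⟦X⟧) ^ m ∣ f m) : Summable f := by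
  apply WithPiTopology.summable_of_tendsto_order_atTop_nhds_top
  refine ENat.tendsto_nhds_top_iff_natCast_lt.mpr
    (fun n ↦ Filter.eventually_atTop.mpr ⟨n + 1, fun m hm ↦ ?_⟩)
  refine lt_of_lt_of_le ?_ (nat_le_order _ m fun d hd ↦ X_pow_dvd_iff.mp (h m) d hd)
  exact_mod_cast hm

theorem multipliable_one_sub_X_pow (e : ℕ → ℕ) (he : ∀ m, m ≤ e m) :
    Multipliable fun m ↦ 1 - (X : K⟦X⟧) ^ e m :=
  multipliable_of_X_pow_dvd _ fun m ↦ by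
    rw [sub_sub_cancel_left, dvd_neg]
    exact pow_dvd_pow _ (he m)

/-- The Jacobi triple product identity. -/
theorem tsum_thetaTerm [DiscreteTopology K] {a b : ℕ} (ha : 1 ≤ a) (hb : 1 ≤ b) :
    ∑' n, thetaTerm K a b n = (∏' m : ℕ, (1 - (X : K⟦X⟧) ^ ((a + b) * (m + 1)))) *
      ((∏' m : ℕ, (1 - (X : K⟦X⟧) ^ ((a + b) * m + a))) *
        ∏' m : ℕ, (1 - (X : K⟦X⟧) ^ ((a + b) * m + b))) := by
  have hc : 1 ≤ a + b := by omega
  have h1 := (multipliable_one_sub_X_pow (K := K) (fun m ↦ (a + b) * (m + 1))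
    fun m ↦ by nlinarith [Nat.le_mul_of_pos_left m hc]).hasProd
  have h2 := (multipliable_one_sub_X_pow (K := K) (fun m ↦ (a + b) * m + a)
    fun m ↦ by nlinarith [Nat.le_mul_of_pos_left m hc]).hasProd
  have h3 := (multipliable_one_sub_X_pow (K := K) (fun m ↦ (a + b) * m + b)
    fun m ↦ by nlinarith [Nat.le_mul_of_pos_left m hc]).hasProd
  have hP := (h1.mul (h2.mul h3)).tendsto_prod_nat
  have hS := (summable_of_X_pow_dvd _ (X_pow_dvd_thetaTerm (K := K) ha hb)).hasSum.tendsto_sum_nat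
  refine tendsto_nhds_unique hS ?_
  -- The coefficients of X^d in the partial products and the partial sums agree once N > d.
  rw [WithPiTopology.tendsto_iff_coeff_tendsto] at hP ⊢
  intro d
  refine (hP d).congr' ?_
  filter_upwards [Filter.eventually_gt_atTop d] with N hN
  have := X_pow_dvd_iff.mp (X_pow_dvd_finite_triple_product_sub (K := K) ha hb N) d hN
  rwa [map_sub, sub_eq_zero] at this

end TripleProduct

end GGA
namespace GGA

/-! ### The summands and the relations between adjacent shelves. -/

section Terms

variable (K : Type*) [Field K]

/-- The quotient `∏_{r=1}^j (1 - q^{2(n+r)}) / ∏_{r=0}^j (1 + q^{2(n+r)+1})`. -/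
noncomputable def ratio (j n : ℕ) : K⟦X⟧ :=
  (∏ r ∈ Finset.Icc 1 j, (1 - X ^ (2 * (n + r)))) *
    (∏ r ∈ Finset.Icc 0 j, (1 + X ^ (2 * (n + r) + 1)))⁻¹

theorem ratio_mul_prod (j n : ℕ) :
    ratio K j n * ∏ r ∈ Finset.range (j + 1), (1 + X ^ (2 * (n + r) + 1)) =
      ∏ r ∈ Finset.range j, (1 - X ^ (2 * (n + r + 1))) := by
  have h1 : Finset.Icc 0 j = Finset.range (j + 1) := by ext; simp
  have h2 : ∏ r ∈ Finset.Icc 1 j, (1 - (X : K⟦X⟧) ^ (2 * (n + r))) =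
      ∏ r ∈ Finset.range j, (1 - X ^ (2 * (n + r + 1))) := by
    have h3 : Finset.Icc 1 j = Finset.Ico 1 (j + 1) := by ext; simp
    rw [h3, Finset.prod_Ico_eq_prod_range, Nat.add_sub_cancel]
    exact Finset.prod_congr rfl fun r _ ↦ by rw [add_comm 1 r, add_assoc]
  rw [ratio, mul_assoc, h1, h2, PowerSeries.inv_mul_cancel, mul_one]
  simp

theorem prod_one_add_X_pow_ne_zero (j n : ℕ) :
    ∏ r ∈ Finset.range j, (1 + (X : K⟦X⟧) ^ (2 * (n + r) + 1)) ≠ 0 := by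
  intro h
  simpa using congrArg constantCoeff h

theorem ratio_zero_mul (n : ℕ) : ratio K 0 n * (1 + X ^ (2 * n + 1)) = 1 := by
  simpa using ratio_mul_prod K 0 n

theorem ratio_mul_right (j n : ℕ) :
    ratio K j n * (1 - X ^ (2 * (n + j + 1))) =
      ratio K (j + 1) n * (1 + X ^ (2 * (n + j + 1) + 1)) := by
  have h1 := ratio_mul_prod K j n
  have h2 := ratio_mul_prod K (j + 1) n
  rw [Finset.prod_range_succ (fun r ↦ 1 + (X : K⟦X⟧) ^ (2 * (n + r) + 1)),
    Finset.prod_range_succ (fun r ↦ 1 - (X : K⟦X⟧) ^ (2 * (n + r + 1)))] at h2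
  apply mul_right_cancel₀ (prod_one_add_X_pow_ne_zero K (j + 1) n)
  rw [← add_assoc n j 1] at h2
  linear_combination (1 - (X : K⟦X⟧) ^ (2 * (n + j + 1))) * h1 - h2

theorem ratio_succ_mul (j n : ℕ) :
    ratio K j (n + 1) * (1 - X ^ (2 * (n + 1))) = ratio K (j + 1) n * (1 + X ^ (2 * n + 1)) := by
  have h1 := ratio_mul_prod K j (n + 1)
  have h2 := ratio_mul_prod K (j + 1) n
  rw [Finset.prod_range_succ' (fun r ↦ 1 + (X : K⟦X⟧) ^ (2 * (n + r) + 1)),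
    Finset.prod_range_succ' (fun r ↦ 1 - (X : K⟦X⟧) ^ (2 * (n + r + 1)))] at h2
  apply mul_right_cancel₀ (prod_one_add_X_pow_ne_zero K (j + 1) (n + 1))
  simp only [add_zero, ← add_assoc, add_right_comm n _ 1] at h1 h2 ⊢
  linear_combination (1 - (X : K⟦X⟧) ^ (2 * (n + 1))) * h1 - h2

theorem two_mul_choose_two_add (n : ℕ) : 2 * n.choose 2 + n = n * n := by
  cases n with
  | zero => rfl
  | succ n =>
    rw [Nat.choose_two_right, Nat.mul_div_cancel' (Nat.even_mul_pred_self (n + 1)).two_dvd]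
    simp; ring

/-- Writing k = i + 1 + d removes truncated subtraction, and 2·C(n,2) + n = n² makes the exponent
polynomial in n, so that `ring` applies. -/
theorem term_eq (i d j n : ℕ) :
    term K (i + 1 + d) j (i + 1) n =
      (-1) ^ n * X ^ (2 * (i + 1 + d) * n * (n + j) + (2 * i + 1) * n) * ratio K j n *
      (1 - X ^ (2 * (d + 1) * (2 * n + j + 1)) +
        X ^ (2 * (n + j) + 1) * (1 - X ^ (2 * d * (2 * n + j + 1)))) := by
  have e1 : i + 1 + d - (i + 1) = d := by omega
  have e2 : 2 * (i + 1 + d) * (j + 1) + 2 * (i + 1) - 1 = 2 * (i + 1 + d) * (j + 1) + (2 * i + 1) := by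
    omega
  have e3 : 4 * (i + 1 + d) * n.choose 2 + (2 * (i + 1 + d) * (j + 1) + (2 * i + 1)) * n =
      2 * (i + 1 + d) * n * (n + j) + (2 * i + 1) * n := by
    linear_combination (2 * (i + 1 + d)) * two_mul_choose_two_add n
  rw [term, e1, e2, e3, ratio]
  ring

theorem X_pow_dvd_term (i d j n : ℕ) : (X : K⟦X⟧) ^ n ∣ term K (i + 1 + d) j (i + 1) n := by
  rw [term_eq]
  refine Dvd.dvd.mul_right (Dvd.dvd.mul_right (Dvd.dvd.mul_left (pow_dvd_pow _ ?_) _) _) _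
  nlinarith [Nat.zero_le (2 * (i + 1 + d) * n * (n + j)), Nat.zero_le (i * n)]

/-- With y = q^(2n+1), the bracket is 1 + y - y^(2d+1) - y^(2d+2) = (1 + y)(1 - y^(2d+1)), and 1 + y
cancels the denominator. -/
theorem term_zero_eq_thetaTerm (i d n : ℕ) :
    term K (i + 1 + d) 0 (i + 1) n = thetaTerm K (2 * d + 1) (4 * i + 2 * d + 3) n := by
  have h := ratio_zero_mul K n
  have e1 : (2 * d + 1 + (4 * i + 2 * d + 3)) * n.choose 2 + (4 * i + 2 * d + 3) * n =
      2 * (i + 1 + d) * n * (n + 0) + (2 * i + 1) * n := by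
    linear_combination (2 * (i + 1 + d)) * two_mul_choose_two_add n
  have e2 : (2 * d + 1 + (4 * i + 2 * d + 3)) * (n + 1).choose 2 + (2 * d + 1) * (n + 1) =
      2 * (i + 1 + d) * n * (n + 0) + (2 * i + 1) * n + (2 * d + 1) * (2 * n + 1) := by
    have e : (n + 1).choose 2 = n + n.choose 2 := by
      rw [Nat.choose_succ_succ' n 1, Nat.choose_one_right]
    rw [e]
    linear_combination (2 * (i + 1 + d)) * two_mul_choose_two_add n
  rw [term_eq, thetaTerm, e1, e2]
  linear_combination (-1) ^ n * X ^ (2 * (i + 1 + d) * n * (n + 0) + (2 * i + 1) * n) *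
    (1 - X ^ ((2 * d + 1) * (2 * n + 1))) * h

end Terms

/-! ### Shelf 0: from the product side to the theta series. -/

section ZerothShelf

variable {K : Type*} [Field K]

open scoped Classical in
-- Indexing products over progressions by all m lets them be multiplied and compared factor by
-- factor.
theorem tprod_one_sub_X_pow_eq [TopologicalSpace K] [DiscreteTopology K] (e : ℕ → ℕ)
    (he : Function.Injective e) :
    ∏' m, (1 - (X : K⟦X⟧) ^ e m) = ∏' m, if m ∈ Set.range e then 1 - (X : K⟦X⟧) ^ m else 1 := by
  rw [← he.tprod_eq (f := fun m ↦ if m ∈ Set.range e then 1 - (X : K⟦X⟧) ^ m else 1)]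
  · simp
  · intro m hm
    by_contra h
    exact hm (if_neg h)

theorem mem_range_mul_add_iff {c a m : ℕ} (hac : a < c) :
    m ∈ Set.range (fun t ↦ c * t + a) ↔ m % c = a := by
  constructor
  · rintro ⟨t, rfl⟩
    simp [Nat.mod_eq_of_lt hac]
  · rintro rfl
    exact ⟨m / c, Nat.div_add_mod m c⟩

theorem mem_range_mul_succ_iff {c m : ℕ} (hc : 0 < c) :
    m ∈ Set.range (fun t ↦ c * (t + 1)) ↔ 1 ≤ m ∧ m % c = 0 := by
  constructor
  · rintro ⟨t, rfl⟩
    exact ⟨Nat.mul_pos hc (Nat.succ_pos t), Nat.mul_mod_right _ _⟩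
  · rintro ⟨h1, h2⟩
    obtain ⟨t, rfl⟩ := Nat.dvd_of_mod_eq_zero h2
    rcases t with _ | t
    · simp at h1
    · exact ⟨t, rfl⟩

theorem intCast_modEq_iff {c a m : ℕ} (hac : a < c) : (m : ℤ) ≡ a [ZMOD c] ↔ m % c = a := by
  rw [Int.natCast_modEq_iff, Nat.ModEq, Nat.mod_eq_of_lt hac]

theorem one_sub_X_pow_mul_inv {m : ℕ} (hm : 1 ≤ m) : (1 - (X : K⟦X⟧) ^ m) * (1 - X ^ m)⁻¹ = 1 :=
  PowerSeries.mul_inv_cancel _ (by simp [Nat.one_le_iff_ne_zero.mp hm])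

open scoped Classical in
theorem FFactor_mul_productFactor (i d m : ℕ) :
    FFactor K m * productFactor K (i + 1 + d) (i + 1) m =
      (if m ∈ Set.range (fun t ↦ 4 * (i + 1 + d) * (t + 1)) then 1 - (X : K⟦X⟧) ^ m else 1) *
      ((if m ∈ Set.range (fun t ↦ 4 * (i + 1 + d) * t + (2 * d + 1)) then 1 - X ^ m else 1) *
      (if m ∈ Set.range (fun t ↦ 4 * (i + 1 + d) * t + (4 * i + 2 * d + 3)) then 1 - X ^ m
        else 1)) := by
  have h0 : (m : ℤ) ≡ 0 [ZMOD 4 * (i + 1 + d : ℕ)] ↔ m % (4 * (i + 1 + d)) = 0 := by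
    have := intCast_modEq_iff (c := 4 * (i + 1 + d)) (a := 0) (m := m) (by omega)
    push_cast at this ⊢
    exact this
  have ha : (m : ℤ) ≡ 2 * (i + 1 + d : ℕ) - (2 * (i + 1 : ℕ) - 1) [ZMOD 4 * (i + 1 + d : ℕ)] ↔
      m % (4 * (i + 1 + d)) = 2 * d + 1 := by
    rw [← intCast_modEq_iff (by omega)]
    push_cast
    ring_nf
  have hb : (m : ℤ) ≡ 2 * (i + 1 + d : ℕ) + (2 * (i + 1 : ℕ) - 1) [ZMOD 4 * (i + 1 + d : ℕ)] ↔
      m % (4 * (i + 1 + d)) = 4 * i + 2 * d + 3 := by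
    rw [← intCast_modEq_iff (by omega)]
    push_cast
    ring_nf
  have h4 : m % 4 = m % (4 * (i + 1 + d)) % 4 := (Nat.mod_mul_right_mod m 4 _).symm
  simp only [FFactor, productFactor, mem_range_mul_succ_iff (show 0 < 4 * (i + 1 + d) by omega),
    mem_range_mul_add_iff (show 2 * d + 1 < 4 * (i + 1 + d) by omega),
    mem_range_mul_add_iff (show 4 * i + 2 * d + 3 < 4 * (i + 1 + d) by omega), h0, ha, hb,
    Nat.ModEq, h4]
  rcases Nat.eq_zero_or_pos m with rfl | hm
  · simp
  simp only [Nat.succ_le_iff.mpr hm, true_and]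
  have hinv := one_sub_X_pow_mul_inv (K := K) hm
  generalize m % (4 * (i + 1 + d)) = ρ at *
  clear h0 ha hb h4
  -- The three residues mod 4k are distinct; one is a multiple of 4k and two are odd, so `omega`
  -- rules out their being 2 mod 4.
  split_ifs <;> first | omega | simp [hinv]

theorem F_mul_productSide [TopologicalSpace K] [DiscreteTopology K] (i d : ℕ) :
    F K * productSide K (i + 1 + d) (i + 1) = ∑' n, term K (i + 1 + d) 0 (i + 1) n := by
  classical
  simp only [term_zero_eq_thetaTerm]
  have e : 2 * d + 1 + (4 * i + 2 * d + 3) = 4 * (i + 1 + d) := by ring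
  rw [tsum_thetaTerm (by omega) (by omega), e]
  have hinj : Function.Injective fun t ↦ 4 * (i + 1 + d) * t :=
    fun _ _ h ↦ Nat.eq_of_mul_eq_mul_left (by omega) h
  have hM : ∀ e : ℕ → ℕ, Multipliable
      fun m ↦ if m ∈ Set.range e then 1 - (X : K⟦X⟧) ^ m else 1 := fun e ↦
    multipliable_of_X_pow_dvd _ fun m ↦ by split_ifs <;> simp
  rw [tprod_one_sub_X_pow_eq (fun t ↦ 4 * (i + 1 + d) * (t + 1))
      (hinj.comp (add_left_injective 1)),
    tprod_one_sub_X_pow_eq (fun t ↦ 4 * (i + 1 + d) * t + (2 * d + 1))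
      ((add_left_injective _).comp hinj),
    tprod_one_sub_X_pow_eq (fun t ↦ 4 * (i + 1 + d) * t + (4 * i + 2 * d + 3))
      ((add_left_injective _).comp hinj),
    ← (hM _).tprod_mul (hM _), ← (hM _).tprod_mul ((hM _).mul (hM _)), F, productSide,
    ← (multipliable_FFactor K).tprod_mul (multipliable_productFactor K _ _)]
  exact tprod_congr fun m ↦ FFactor_mul_productFactor i d m

end ZerothShelf

end GGA
namespace GGA

/-! ### Shelf recursion by shifting half of a split sum. -/

section Recursion

variable (K : Type*) [Field K]

theorem summable_term [TopologicalSpace K] (i d j : ℕ) :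
    Summable (term K (i + 1 + d) j (i + 1)) :=
  summable_of_X_pow_dvd _ (X_pow_dvd_term K i d j)

theorem tsum_add_eq_tsum_add_succ [TopologicalSpace K] [DiscreteTopology K] (U V : ℕ → K⟦X⟧)
    (hU : ∀ n, X ^ n ∣ U n) (hV : ∀ n, X ^ n ∣ V n) (hU0 : U 0 = 0) :
    ∑' n, (U n + V n) = ∑' n, (V n + U (n + 1)) := by
  have hU := summable_of_X_pow_dvd U hU
  have hV := summable_of_X_pow_dvd V hV
  rw [hU.tsum_add hV, hV.tsum_add ((summable_nat_add_iff 1).mpr hU), hU.tsum_eq_zero_add, hU0,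
    zero_add, add_comm]

/-- The last series of a shelf agrees with the first series of the next shelf. -/
theorem tsum_term_first [TopologicalSpace K] [DiscreteTopology K] (d j : ℕ) :
    ∑' n, term K (d + 1) (j + 1) 1 n = ∑' n, term K (d + 1) j (d + 1) n := by
  let U : ℕ → K⟦X⟧ := fun n ↦ (-1) ^ n * X ^ (2 * (d + 1) * n * (n + j) + (2 * d + 1) * n) *
    ratio K j n * (1 - X ^ (2 * n))
  let V : ℕ → K⟦X⟧ := fun n ↦ (-1) ^ n * X ^ (2 * (d + 1) * n * (n + j) + (2 * d + 3) * n) *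
    ratio K j n * (1 - X ^ (2 * (n + j + 1)))
  have hU : ∀ n, X ^ n ∣ U n := fun n ↦
    Dvd.dvd.mul_right (Dvd.dvd.mul_right (Dvd.dvd.mul_left (pow_dvd_pow _ (by
      nlinarith [Nat.zero_le (2 * (d + 1) * n * (n + j)), Nat.zero_le (d * n)])) _) _) _
  have hV : ∀ n, X ^ n ∣ V n := fun n ↦
    Dvd.dvd.mul_right (Dvd.dvd.mul_right (Dvd.dvd.mul_left (pow_dvd_pow _ (by
      nlinarith [Nat.zero_le (2 * (d + 1) * n * (n + j)), Nat.zero_le (d * n)])) _) _) _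
  have h := tsum_add_eq_tsum_add_succ K U V hU hV (by simp [U])
  calc _ = ∑' n, (V n + U (n + 1)) := tsum_congr fun n ↦ ?_
    _ = ∑' n, (U n + V n) := h.symm
    _ = _ := tsum_congr fun n ↦ ?_
  · have ht := term_eq K 0 d (j + 1) n
    rw [show 0 + 1 + d = d + 1 by ring, zero_add] at ht
    rw [ht]
    have h1 := ratio_mul_right K j n
    have h2 := ratio_succ_mul K j n
    simp only [U, V]
    linear_combination -((-1) ^ n * X ^ (2 * (d + 1) * n * (n + j) + (2 * d + 3) * n)) * h1 -
      (-1) ^ (n + 1) * X ^ (2 * (d + 1) * (n + 1) * (n + 1 + j) + (2 * d + 1) * (n + 1)) * h2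
  · have ht := term_eq K d 0 j n
    rw [add_zero] at ht
    rw [ht]
    simp only [U, V]
    ring

/-- The recursion satisfied by the alternating sums. -/
theorem tsum_term_recursion [TopologicalSpace K] [DiscreteTopology K] (p d j : ℕ) :
    X ^ (2 * (j + 1) * (p + 1) + 1) * ∑' n, term K (p + 2 + d) (j + 1) (p + 2) n +
      X ^ (2 * (j + 1) * (p + 1)) * ∑' n, term K (p + 2 + d) (j + 1) (p + 1) n =
    X * (∑' n, term K (p + 2 + d) j (d + 1) n - ∑' n, term K (p + 2 + d) j (d + 2) n) := by
  have t1 : ∀ n, term K (p + 2 + d) (j + 1) (p + 2) n = _ := term_eq K (p + 1) d (j + 1)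
  have t2 := term_eq K p (d + 1) (j + 1)
  rw [show p + 1 + (d + 1) = p + 2 + d by ring] at t2
  have t3 := term_eq K d (p + 1) j
  rw [show d + 1 + (p + 1) = p + 2 + d by ring] at t3
  have t4 := term_eq K (d + 1) p j
  rw [show d + 1 + 1 + p = p + 2 + d by ring] at t4
  have s1 : Summable (term K (p + 2 + d) (j + 1) (p + 2)) := summable_term K (p + 1) d (j + 1)
  have s2 := summable_term K p (d + 1) (j + 1)
  rw [show p + 1 + (d + 1) = p + 2 + d by ring] at s2
  have s3 := summable_term K d (p + 1) j
  rw [show d + 1 + (p + 1) = p + 2 + d by ring] at s3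
  have s4 := summable_term K (d + 1) p j
  rw [show d + 1 + 1 + p = p + 2 + d by ring] at s4
  -- U collects the monomials of X times the difference whose exponents do not involve p·(2n+j+1), V
  -- the others. The extra factor X makes both factor, since q^(2(n+j)+1) · q^(2n+1) =
  -- q^(2(2n+j+1)).
  let U : ℕ → K⟦X⟧ := fun n ↦
    (-1) ^ n * X ^ (1 + 2 * (p + 2 + d) * n * (n + j) + (2 * d + 1) * n) *
    ratio K j n * ((1 - X ^ (2 * n)) * (1 + X ^ (2 * (n + j) + 1)))
  let V : ℕ → K⟦X⟧ := fun n ↦ (-1) ^ n *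
    X ^ (2 * (p + 2 + d) * n * (n + j) + (2 * d + 1) * n + 2 * (p + 1) * (2 * n + j + 1)) *
    ratio K j n * ((1 + X ^ (2 * n + 1)) * (1 - X ^ (2 * (n + j + 1))))
  have hU : ∀ n, X ^ n ∣ U n := fun n ↦
    Dvd.dvd.mul_right (Dvd.dvd.mul_right (Dvd.dvd.mul_left (pow_dvd_pow _ (by
      nlinarith [Nat.zero_le (2 * (p + 2 + d) * n * (n + j)), Nat.zero_le (d * n)])) _) _) _
  have hV : ∀ n, X ^ n ∣ V n := fun n ↦
    Dvd.dvd.mul_right (Dvd.dvd.mul_right (Dvd.dvd.mul_left (pow_dvd_pow _ (by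
      nlinarith [Nat.zero_le (2 * (p + 2 + d) * n * (n + j)), Nat.zero_le (d * n),
        Nat.zero_le (2 * (p + 1) * (2 * n + j + 1))])) _) _) _
  have h := tsum_add_eq_tsum_add_succ K U V hU hV (by simp [U])
  rw [← s1.tsum_mul_left, ← s2.tsum_mul_left, ← (s1.mul_left _).tsum_add (s2.mul_left _),
    ← s3.tsum_sub s4, ← (s3.sub s4).tsum_mul_left]
  calc _ = ∑' n, (V n + U (n + 1)) := tsum_congr fun n ↦ ?_
    _ = ∑' n, (U n + V n) := h.symm
    _ = _ := tsum_congr fun n ↦ ?_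
  · rw [t1, t2]
    have h1 := ratio_mul_right K j n
    have h2 := ratio_succ_mul K j n
    simp only [U, V]
    linear_combination -((-1) ^ n *
      X ^ (2 * (p + 2 + d) * n * (n + j) + (2 * d + 1) * n + 2 * (p + 1) * (2 * n + j + 1)) *
        (1 + X ^ (2 * n + 1))) * h1 -
      (-1) ^ (n + 1) *
        X ^ (1 + 2 * (p + 2 + d) * (n + 1) * (n + 1 + j) + (2 * d + 1) * (n + 1)) *
        (1 + X ^ (2 * (n + 1 + j) + 1)) * h2
  · rw [t3, t4]
    simp only [U, V]
    ring

end Recursion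

/-! ### Induction over shelves j and positions i. -/

section Main

variable {K : Type*} [Field K] [TopologicalSpace K] [DiscreteTopology K]

theorem G_eq (k : ℕ) (hk : 2 ≤ k) (j i : ℕ) (hi : 1 ≤ i) (hik : i ≤ k) :
    G K k ((k - 1) * j + i) = (((F K)⁻¹ * ∑' n : ℕ, term K k j i n : K⟦X⟧) : K⸨X⸩) := by
  induction j generalizing i with
  | zero =>
    obtain ⟨i, rfl⟩ := Nat.exists_eq_add_of_le' hi
    obtain ⟨d, rfl⟩ := Nat.exists_eq_add_of_le hik
    rw [mul_zero, zero_add, G_zeroth_shelf K _ _ hik, ← F_mul_productSide, ← mul_assoc,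
      PowerSeries.inv_mul_cancel _ (by simp [constantCoeff_F]), one_mul]
  | succ j ihj =>
    induction i, hi using Nat.le_induction with
    | base =>
      -- The recursion starts at i = 2; for i = 1 the index is (k-1)j + k, the last one of the
      -- previous shelf.
      obtain ⟨d, rfl⟩ := Nat.exists_eq_add_of_le' (show 1 ≤ k by omega)
      rw [tsum_term_first, ← ihj (d + 1) (by omega) le_rfl]
      congr 1
    | succ i hi ih =>
      obtain ⟨p, rfl⟩ := Nat.exists_eq_add_of_le' hi
      obtain ⟨d, rfl⟩ := Nat.exists_eq_add_of_le hik
      have hq : q K ≠ 0 := by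
        simp [q]
      rw [G_recursion K _ _ _ hk (by omega) (by omega) hik]
      have e1 : (p + 1 + 1 + d - 1) * (j + 1 - 1) + (p + 1 + 1 + d) - (p + 1 + 1) + 1 =
          (p + 1 + 1 + d - 1) * j + (d + 1) := by
        rw [Nat.add_sub_cancel]; omega
      have e2 : (p + 1 + 1 + d - 1) * (j + 1 - 1) + (p + 1 + 1 + d) - (p + 1 + 1) + 2 =
          (p + 1 + 1 + d - 1) * j + (d + 2) := by
        rw [Nat.add_sub_cancel]; omega
      have e3 : (p + 1 + 1 + d - 1) * (j + 1) + (p + 1 + 1) - 1 =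
          (p + 1 + 1 + d - 1) * (j + 1) + (p + 1) := by omega
      rw [e1, e2, e3, ih (by omega), ihj _ (by omega) (by omega), ihj _ (by omega) (by omega),
        Nat.add_sub_cancel]
      have h := congrArg (fun f : K⟦X⟧ ↦ (((F K)⁻¹ * f : K⟦X⟧) : K⸨X⸩)) (tsum_term_recursion K p d j)
      simp only [PowerSeries.coe_mul, PowerSeries.coe_add, PowerSeries.coe_sub, PowerSeries.coe_pow]
        at h ⊢
      rw [show ((X : K⟦X⟧) : K⸨X⸩) = q K from rfl] at h
      field_simp
      linear_combination -h

end Main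

end GGA

theorem mainTheorem2 {K : Type*} [Field K] [TopologicalSpace K] [DiscreteTopology K]
    (k : ℕ) (hk : 2 ≤ k) (j i : ℕ) (hi : 1 ≤ i) (hik : i ≤ k) :
    Summable (GGA.term K k j i) ∧
      GGA.G K k ((k - 1) * j + i) =
        (((GGA.F K)⁻¹ * ∑' n : ℕ, GGA.term K k j i n : K⟦X⟧) : K⸨X⸩) := by
  refine ⟨?_, GGA.G_eq k hk j i hi hik⟩
  obtain ⟨i, rfl⟩ := Nat.exists_eq_add_of_le' hi
  obtain ⟨d, rfl⟩ := Nat.exists_eq_add_of_le hik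
  exact GGA.summable_term K i d j
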